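/- **Adaptive job search.** Let $\mathsf X=[w_l,w_h]\subset[0,\infty)$ be a compact interval, $\beta\in(0,1)$, $c_0\in\mathsf X$, and let $f,g$ be two probability densities (with respect to Lebesgue measure) on $\mathsf X$. Put $h_\pi(w')=\pi f(w')+(1-\pi)g(w')$ and $q(w',\pi)=\pi f(w')/h_\pi(w')$ for $\pi\in[0,1]$ (set $q=0$ where $h_\pi(w')=0$, an event of probability zero under $h_\pi$). The state space is $\mathsf Z=\mathsf X\times[0,1]$, and $P$ is the stochastic kernel on $\mathsf Z$ given by $$\int \phi\,dP((w,\pi),\cdot)=\int_{\mathsf X}\phi\big(w',q(w',\pi)\big)\,h_\pi(w')\,dw' .$$ Let $(Z_t)_{t\ge0}$ be a $\mathsf Z$-valued process adapted to a filtration $(\mathscr F_t)$ which, under each probability $\mathbb P_z$ ($z\in\mathsf Z$), starts at $z$ and is a time-homogeneous Markov process with kernel $P$ relative to $(\mathscr F_t)$. Write $r(w,\pi)=w/(1-\beta)$. For a stopping time $\tau$ the expected payoff from $z$ is $$J(\tau,z)=\mathbb E_z\Big[\sum_{t=0}^{\tau-1}\beta^t c_0+\beta^\tau r(Z_\tau)\Big],$$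 where on $\{\tau=\infty\}$ the payoff is read as $\sum_{t\ge0}\beta^tc_0$. The value function $v^*(z)$ is the supremum of $J(\tau,z)$ over stopping times with $\mathbb P_z\{\tau<\infty\}=1$, and the continuation value is $c_0+\beta\int v^*(z')P(z,dz')$. A reservation wage is a function $\bar w$ on $[0,1]$ with values in $\mathsf X$ such that, at belief $\pi$, the exit payoff and the continuation value agree at the offer $w\in\mathsf X$ exactly when $w=\bar w(\pi)$. A policy $\sigma:\mathsf Z\to\{0,1\}$ is optimal if $\tau_\sigma=\inf\{t\ge0:\sigma(Z_t)=1\}$ (with $\inf\emptyset=\infty$) is a stopping time and, for every $z$, $J(\tau_\sigma,z)=v^*(z)$ and $J(\tau,z)\le J(\tau_\sigma,z)$ for all stopping times $\tau$, finite or not. Let $b[0,1]$ be the bounded Borel functions on $[0,1]$ with the supremum norm, and for $\psi\in b[0,1]$ $$Q\psi(\pi)=c_0+\beta\int_{\mathsf X}\max\Big\{\frac{w'}{1-\beta},\ \psi\big(q(w',\pi)\big)\Big\}h_\pi(w')\,dw' .$$ **Proposition.** 1. $Q$ maps $b[0,1]$ to itself and is a contraction of modulus $\beta$ there, with a unique fixed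 point $\psi^*\in b[0,1]$. 2. All payoffs above are integrable. The continuation value at $(w,\pi)$ is $\psi^*(\pi)$; the value function is $v^*(w,\pi)=\frac{w}{1-\beta}\vee\psi^*(\pi)$; the reservation wage is $\bar w(\pi)=(1-\beta)\psi^*(\pi)$; and $\sigma^*(w,\pi)=\mathbb 1\{w\ge\bar w(\pi)\}$ is an optimal policy. 3. $\psi^*$, $\bar w$ and $v^*$ are continuous. -/

import Mathlib

open MeasureTheory ProbabilityTheory Set
open scoped unitInterval ENNReal

noncomputable section

attribute [local instance] MeasureTheory.Measure.Subtype.measureSpace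

/-- A probability density, with respect to Lebesgue measure, on the interval `[a, b]`. -/
structure IsDensityOn {a b : ℝ} (f : Icc a b → ℝ) : Prop where
  measurable : Measurable f
  nonneg : ∀ w, 0 ≤ f w
  integral_eq_one : ∫ w, f w = 1

/-- The primitives of the adaptive job search model: a compact wage interval `[wl, wh]` in the
nonnegative reals, a discount factor `β`, an unemployment compensation `c₀`, and two candidate
densities `f` and `g` of the wage offer. -/
structure SearchModel where
  wl : ℝ
  wh : ℝ
  wl_nonneg : 0 ≤ wl
  β : ℝ
  β_pos : 0 < β
  β_lt_one : β < 1
  c₀ : ℝ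
  f : Icc wl wh → ℝ
  g : Icc wl wh → ℝ
  f_density : IsDensityOn f
  g_density : IsDensityOn g

/-- `b[0,1]`: Borel measurable bounded real functions on the unit interval. -/
def IsBddMeasurable (ψ : I → ℝ) : Prop :=
  Measurable ψ ∧ ∃ C : ℝ, ∀ π, |ψ π| ≤ C

/-- The supremum norm (of a bounded function on the unit interval). -/
def supNorm (ψ : I → ℝ) : ℝ := ⨆ π, |ψ π|

namespace SearchModel

variable (M : SearchModel)

/-- The set of wages `X = [wl, wh]`. -/
abbrev Wage : Type := Icc M.wl M.wh

/-- The state space `Z = X × [0,1]`, with states `(w, π)`. -/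
abbrev State : Type := M.Wage × I

/-- `h_π(w') = π f(w') + (1 - π) g(w')`, the subjective density of the next wage offer. -/
def mixture (π : I) (w' : M.Wage) : ℝ := (π : ℝ) * M.f w' + (1 - (π : ℝ)) * M.g w'

theorem mixture_nonneg (π : I) (w' : M.Wage) : 0 ≤ M.mixture π w' :=
  add_nonneg (mul_nonneg π.2.1 (M.f_density.nonneg w'))
    (mul_nonneg (sub_nonneg.2 π.2.2) (M.g_density.nonneg w'))

/-- Bayes' rule `q(w', π) = π f(w') / (π f(w') + (1 - π) g(w'))`. Where the denominator vanishes
(an event of probability zero under `h_π`) the value is `0`. -/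
def update (w' : M.Wage) (π : I) : I :=
  ⟨(π : ℝ) * M.f w' / M.mixture π w',
    div_nonneg (mul_nonneg π.2.1 (M.f_density.nonneg w')) (M.mixture_nonneg π w'),
    div_le_one_of_le₀
      (le_add_of_nonneg_right (mul_nonneg (sub_nonneg.2 π.2.2) (M.g_density.nonneg w')))
      (M.mixture_nonneg π w')⟩

theorem measurable_mixture : Measurable fun p : I × M.Wage => M.mixture p.1 p.2 := by
  have hf := M.f_density.measurable
  have hg := M.g_density.measurable
  unfold mixture
  fun_prop

theorem measurable_update : Measurable fun p : M.Wage × I => M.update p.1 p.2 := by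
  have hf := M.f_density.measurable
  have hm : Measurable fun p : M.Wage × I => M.mixture p.2 p.1 :=
    M.measurable_mixture.comp measurable_swap
  refine Measurable.subtype_mk ?_
  fun_prop

/-- The Jovanovic operator
`Q ψ(π) = c₀ + β ∫ max {w' / (1 - β), ψ(q(w', π))} h_π(w') dw'`. -/
def Q (ψ : I → ℝ) (π : I) : ℝ :=
  M.c₀ + M.β * ∫ w' : M.Wage,
    max ((w' : ℝ) / (1 - M.β)) (ψ (M.update w' π)) * M.mixture π w'

/-- The exit payoff `r(w, π) = w / (1 - β)`. -/
def exitPayoff (z : M.State) : ℝ := (z.1 : ℝ) / (1 - M.β)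

/-- The transition kernel of the state: from `(w, π)`, the next offer `w'` has density `h_π`
and the next belief is `q(w', π)`. -/
def transition : Kernel M.State M.State where
  toFun z := ((volume : Measure M.Wage).withDensity fun w' =>
    ENNReal.ofReal (M.mixture z.2 w')).map fun w' => (w', M.update w' z.2)
  measurable' := by
    refine Measure.measurable_of_measurable_coe _ fun B hB => ?_
    have hu : Measurable fun p : M.State × M.Wage => (p.2, M.update p.2 p.1.2) :=
      measurable_snd.prodMk
        (M.measurable_update.comp (measurable_snd.prodMk (measurable_snd.comp measurable_fst)))
    have hz : ∀ z : M.State, Measurable fun w' : M.Wage => (w', M.update w' z.2) :=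
      fun z => hu.comp (measurable_const.prodMk measurable_id)
    have hm : Measurable fun p : M.State × M.Wage => ENNReal.ofReal (M.mixture p.1.2 p.2) :=
      (M.measurable_mixture.comp
        ((measurable_snd.comp measurable_fst).prodMk measurable_snd)).ennreal_ofReal
    have : IsFiniteMeasure (volume : Measure M.Wage) := by
      refine ⟨?_⟩
      rw [Measure.Subtype.volume_univ measurableSet_Icc.nullMeasurableSet, Real.volume_Icc]
      exact ENNReal.ofReal_lt_top
    have key := (hm.indicator (hu hB)).lintegral_prod_right' (ν := (volume : Measure M.Wage))
    convert key using 2 with z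
    rw [Measure.map_apply (hz z) hB, withDensity_apply _ (hz z hB),
      ← lintegral_indicator (hz z hB)]
    rfl

/-- The state (Markov) process on a measurable space `Ω`, with an information filtration `ℱ`: under `P z`
the adapted process `Z` starts at `z` and is, relative to `ℱ`, a time-homogeneous Markov process
with the transition kernel of the model. -/
structure StateChain (Ω : Type*) [mΩ : MeasurableSpace Ω] where
  ℱ : Filtration ℕ mΩ
  Z : ℕ → Ω → M.State
  P : M.State → Measure Ω
  isProbabilityMeasure : ∀ z, IsProbabilityMeasure (P z)
  adapted : ∀ n, Measurable[ℱ n] (Z n)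
  initial : ∀ z, ∀ᵐ ω ∂(P z), Z 0 ω = z
  markov : ∀ (z : M.State) (n : ℕ) (B : Set M.State), MeasurableSet B →
    (P z)[(Z (n + 1) ⁻¹' B).indicator (fun _ => (1 : ℝ)) | ℱ n]
      =ᵐ[P z] fun ω => (M.transition (Z n ω)).real B

namespace StateChain

variable {M} {Ω : Type*} [mΩ : MeasurableSpace Ω] (S : M.StateChain Ω)

/-- The total discounted payoff of stopping at `τ`, that is
`∑_{t < τ} β^t c₀ + β^τ r(Z_τ)`; if one never stops, it is `∑_{t ≥ 0} β^t c₀`. -/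
def payoff (τ : Ω → WithTop ℕ) (ω : Ω) : ℝ :=
  if τ ω = ⊤ then ∑' t : ℕ, M.β ^ t * M.c₀
  else (∑ t ∈ Finset.range ((τ ω).untopD 0), M.β ^ t * M.c₀)
    + M.β ^ ((τ ω).untopD 0) * M.exitPayoff (S.Z ((τ ω).untopD 0) ω)

/-- `E_z` of the total discounted payoff. -/
def expectedPayoff (τ : Ω → WithTop ℕ) (z : M.State) : ℝ := ∫ ω, S.payoff τ ω ∂(S.P z)

/-- The value function `v*`: the supremum of the expected payoff over the stopping times that are
finite with probability one. -/
def value (z : M.State) : ℝ :=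
  sSup {x | ∃ τ : Ω → WithTop ℕ, IsStoppingTime S.ℱ τ ∧ (∀ᵐ ω ∂(S.P z), τ ω ≠ ⊤) ∧
    x = S.expectedPayoff τ z}

/-- The continuation value function `c₀ + β ∫ v*(z') P(z, dz')`. -/
def continuationValue (z : M.State) : ℝ :=
  M.c₀ + M.β * ∫ z', S.value z' ∂(M.transition z)

/-- `wbar` is the reservation wage: `wbar π` is an offer in `X`, and it is the one at which the
worker is indifferent between accepting and rejecting. -/
def IsReservationWage (wbar : I → ℝ) : Prop :=
  ∀ π : I, wbar π ∈ Icc M.wl M.wh ∧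
    ∀ w : M.Wage, M.exitPayoff (w, π) = S.continuationValue (w, π) ↔ (w : ℝ) = wbar π

/-- `τ* = inf {t ≥ 0 | pol(Z_t) = 1}`, with `inf ∅ = ∞`. -/
def policyTime (pol : M.State → Fin 2) : Ω → WithTop ℕ := hittingAfter S.Z {z | pol z = 1} 0

/-- A policy is optimal if, from every initial state, its stopping time attains the supremum that
defines the value function, and no other stopping time, finite or not, does better. -/
def IsOptimalPolicy (pol : M.State → Fin 2) : Prop :=
  IsStoppingTime S.ℱ (S.policyTime pol) ∧
    ∀ z : M.State, S.expectedPayoff (S.policyTime pol) z = S.value z ∧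
      ∀ τ : Ω → WithTop ℕ, IsStoppingTime S.ℱ τ →
        S.expectedPayoff τ z ≤ S.expectedPayoff (S.policyTime pol) z

end StateChain

theorem lintegral_mixture (π : I) :
    ∫⁻ w' : M.Wage, ENNReal.ofReal (M.mixture π w') = 1 := by
  have hf : Integrable M.f := by
    by_contra h
    exact zero_ne_one ((integral_undef h).symm.trans M.f_density.integral_eq_one)
  have hg : Integrable M.g := by
    by_contra h
    exact zero_ne_one ((integral_undef h).symm.trans M.g_density.integral_eq_one)
  have hi : Integrable (M.mixture π) := (hf.const_mul _).add (hg.const_mul _)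
  rw [← ofReal_integral_eq_lintegral_ofReal hi (Filter.Eventually.of_forall (M.mixture_nonneg π))]
  have : ∫ w' : M.Wage, M.mixture π w' = 1 := by
    unfold mixture
    rw [integral_add (hf.const_mul _) (hg.const_mul _), integral_const_mul, integral_const_mul,
      M.f_density.integral_eq_one, M.g_density.integral_eq_one]
    ring
  rw [this, ENNReal.ofReal_one]

instance : IsMarkovKernel M.transition := by
  refine ⟨fun z => ⟨?_⟩⟩
  have hz : Measurable fun w' : M.Wage => (w', M.update w' z.2) :=
    measurable_id.prodMk (M.measurable_update.comp (measurable_id.prodMk measurable_const))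
  change (((volume : Measure M.Wage).withDensity fun w' =>
    ENNReal.ofReal (M.mixture z.2 w')).map fun w' => (w', M.update w' z.2)) univ = 1
  rw [Measure.map_apply hz MeasurableSet.univ, preimage_univ, withDensity_apply _ MeasurableSet.univ,
    Measure.restrict_univ, M.lintegral_mixture]

/-- The one-step kernels of the canonical process, as functions of the past. -/
def pastKernel (n : ℕ) : Kernel ((i : Finset.Iic n) → M.State) M.State :=
  M.transition.comap (fun x => x ⟨n, Finset.mem_Iic.2 le_rfl⟩) (measurable_pi_apply _)

instance (n : ℕ) : IsMarkovKernel (M.pastKernel n) := by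
  unfold pastKernel; infer_instance

/-- The canonical state process, on the space of sequences of states with its coordinate
filtration: an instance of the notion of state process. -/
def canonicalChain : M.StateChain (ℕ → M.State) where
  ℱ := Filtration.piLE
  Z n ω := ω n
  P z := Kernel.traj (X := fun _ => M.State) M.pastKernel 0 fun _ => z
  isProbabilityMeasure z := inferInstance
  adapted n := by
    rw [Filtration.piLE_eq_comap_frestrictLe]
    exact (measurable_pi_apply (⟨n, Finset.mem_Iic.2 le_rfl⟩ : Finset.Iic n)).comp
      (comap_measurable (Preorder.frestrictLe (π := fun _ : ℕ => M.State) n))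
  initial z := by
    have h := Kernel.traj_map_frestrictLe_apply (X := fun _ => M.State) (κ := M.pastKernel) 0 0
      (fun _ => z)
    rw [Kernel.partialTraj_self, Kernel.id_apply] at h
    have h2 : ∀ᵐ x ∂((Kernel.traj (X := fun _ => M.State) M.pastKernel 0 fun _ => z).map
        (Preorder.frestrictLe (π := fun _ : ℕ => M.State) 0)),
        x ⟨0, Finset.mem_Iic.2 le_rfl⟩ = z := by
      rw [h, ae_dirac_iff (measurableSet_eq_fun (measurable_pi_apply _) measurable_const)]
    exact ae_of_ae_map (by fun_prop) h2
  markov z n B hB := by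
    have hB' : MeasurableSet ((fun ω : ℕ → M.State => ω (n + 1)) ⁻¹' B) :=
      measurable_pi_apply (n + 1) hB
    have hi : Integrable (((fun ω : ℕ → M.State => ω (n + 1)) ⁻¹' B).indicator
        fun _ => (1 : ℝ)) (Kernel.traj (X := fun _ => M.State) M.pastKernel 0 fun _ => z) :=
      (integrable_const 1).indicator hB'
    refine (Kernel.condExp_traj (X := fun _ => M.State) (Nat.zero_le n) hi).trans
      (Filter.Eventually.of_forall fun ω => ?_)
    change ∫ y, _ ∂_ = _
    rw [integral_indicator_const _ hB', smul_eq_mul, mul_one, measureReal_def,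
      ← Measure.map_apply (measurable_pi_apply (n + 1)) hB,
      ← Kernel.map_apply _ (measurable_pi_apply (n + 1)),
      Kernel.map_traj_succ_self (X := fun _ => M.State)]
    rfl

end SearchModel

end

noncomputable section

attribute [local instance] MeasureTheory.Measure.Subtype.measureSpace

/-! Averaging against the probability density `h_π` preserves bounds, and `max` with a fixed number
is 1-Lipschitz, so `Q` contracts sup distances by `β` (`abs_Q_sub_Q_le`). `Q` also preserves
continuity: Bayes' rule can jump only where `h_π(w')` vanishes, and there the integrand is killed by
its weight (`continuous_exitOrContinue_mul_mixture`). Banach's theorem in the complete space `C(I,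
ℝ)` thus yields a continuous fixed point `ψ`, and the contraction estimate makes it unique among all
bounded Borel functions.

The rest is a verification argument. Put `V = exitOrContinue ψ`. The fixed-point equation says `c₀ +
β ∫ V dP = ψ` (`continuation_eq`), so by the Markov property the process `∑_{t<n} β^t c₀ + β^n
V(Z_n)` has conditional drift `β^n (ψ - V)(Z_n) ≤ 0`. Optional stopping at `min τ n`, then dominated
convergence, bounds every expected payoff by `V(z)`. Under the reservation policy `V = ψ` before
stopping and `V = r` on stopping, so equality holds. Discounting makes the payoff at `τ = ∞` the
limit of the truncated ones, so no almost sure finiteness of the optimal time is needed. -/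

theorem IsDensityOn.integrable {a b : ℝ} {f : Icc a b → ℝ} (h : IsDensityOn f) :
    Integrable f := by
  by_contra hf
  -- A non-integrable function has Bochner integral `0` by convention, which contradicts total mass
  -- `1`.
  exact zero_ne_one ((integral_undef hf).symm.trans h.integral_eq_one)

theorem IsBddMeasurable.of_continuous {ψ : I → ℝ} (h : Continuous ψ) : IsBddMeasurable ψ := by
  obtain ⟨C, hC⟩ := isCompact_univ.exists_bound_of_continuousOn h.continuousOn
  exact ⟨h.measurable, C, fun π => hC π (mem_univ π)⟩

theorem IsBddMeasurable.sub {ψ φ : I → ℝ} (hψ : IsBddMeasurable ψ) (hφ : IsBddMeasurable φ) :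
    IsBddMeasurable (ψ - φ) := by
  obtain ⟨C, hC⟩ := hψ.2
  obtain ⟨D, hD⟩ := hφ.2
  exact ⟨hψ.1.sub hφ.1, C + D, fun π => (abs_sub _ _).trans (add_le_add (hC π) (hD π))⟩

/-- Boundedness is essential: the real `⨆` of an unbounded family takes a default value and
dominates nothing. -/
theorem IsBddMeasurable.abs_le_supNorm {ψ : I → ℝ} (h : IsBddMeasurable ψ) (π : I) :
    |ψ π| ≤ supNorm ψ := by
  obtain ⟨C, hC⟩ := h.2
  exact le_ciSup (f := fun π => |ψ π|) ⟨C, forall_mem_range.2 hC⟩ π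

/-! ### Averaging against `h_π` and the contraction estimate. -/

namespace SearchModel

variable (M : SearchModel)

theorem one_sub_β_pos : 0 < 1 - M.β := sub_pos.2 M.β_lt_one

theorem isFiniteMeasure_volume_wage : IsFiniteMeasure (volume : Measure M.Wage) := by
  refine ⟨?_⟩
  rw [Measure.Subtype.volume_univ measurableSet_Icc.nullMeasurableSet, Real.volume_Icc]
  exact ENNReal.ofReal_lt_top

attribute [local instance] isFiniteMeasure_volume_wage

theorem measurable_mixture_left (π : I) : Measurable (M.mixture π) :=
  M.measurable_mixture.comp (measurable_const.prodMk measurable_id)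

theorem measurable_update_left (π : I) : Measurable fun w' => M.update w' π :=
  M.measurable_update.comp (measurable_id.prodMk measurable_const)

theorem integrable_mixture (π : I) : Integrable (M.mixture π) :=
  (M.f_density.integrable.const_mul _).add (M.g_density.integrable.const_mul _)

theorem integral_mixture (π : I) : ∫ w', M.mixture π w' = 1 := by
  unfold mixture
  rw [integral_add (M.f_density.integrable.const_mul _) (M.g_density.integrable.const_mul _),
    integral_const_mul, integral_const_mul, M.f_density.integral_eq_one,
    M.g_density.integral_eq_one]
  ring

/-- The larger of the exit payoff and a belief-dependent continuation value. -/
def exitOrContinue (ψ : I → ℝ) (z : M.State) : ℝ := max ((z.1 : ℝ) / (1 - M.β)) (ψ z.2)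

theorem exitPayoff_mem (z : M.State) :
    M.exitPayoff z ∈ Icc (M.wl / (1 - M.β)) (M.wh / (1 - M.β)) :=
  ⟨div_le_div_of_nonneg_right z.1.2.1 M.one_sub_β_pos.le,
    div_le_div_of_nonneg_right z.1.2.2 M.one_sub_β_pos.le⟩

theorem abs_exitPayoff_le (z : M.State) : |M.exitPayoff z| ≤ M.wh / (1 - M.β) := by
  have h := M.exitPayoff_mem z
  rw [abs_of_nonneg ((div_nonneg M.wl_nonneg M.one_sub_β_pos.le).trans h.1)]
  exact h.2

theorem measurable_exitPayoff : Measurable M.exitPayoff := by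
  unfold exitPayoff
  fun_prop

variable {M}

theorem measurable_exitOrContinue {ψ : I → ℝ} (hψ : IsBddMeasurable ψ) :
    Measurable (M.exitOrContinue ψ) :=
  M.measurable_exitPayoff.max (hψ.1.comp measurable_snd)

theorem exists_abs_exitOrContinue_le {ψ : I → ℝ} (hψ : IsBddMeasurable ψ) :
    ∃ C, ∀ z, |M.exitOrContinue ψ z| ≤ C := by
  obtain ⟨C, hC⟩ := hψ.2
  exact ⟨max (M.wh / (1 - M.β)) C, fun z =>
    abs_max_le_max_abs_abs.trans (max_le_max (M.abs_exitPayoff_le z) (hC z.2))⟩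

variable (M) in
theorem Q_eq (ψ : I → ℝ) (π : I) : M.Q ψ π =
    M.c₀ + M.β * ∫ w', M.exitOrContinue ψ (w', M.update w' π) * M.mixture π w' := rfl

theorem integrable_mul_mixture {φ : M.State → ℝ} (hφ : Measurable φ) {C : ℝ}
    (hC : ∀ z, |φ z| ≤ C) (π : I) :
    Integrable fun w' : M.Wage => φ (w', M.update w' π) * M.mixture π w' :=
  (M.integrable_mixture π).bdd_mul
    (hφ.comp (measurable_id.prodMk (M.measurable_update_left π))).aestronglyMeasurable
    (Filter.Eventually.of_forall fun _ => hC _)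

theorem integral_mul_mixture_le {φ : M.State → ℝ} (hφ : Measurable φ) {C b : ℝ}
    (hC : ∀ z, |φ z| ≤ C) (hb : ∀ z, φ z ≤ b) (π : I) :
    ∫ w' : M.Wage, φ (w', M.update w' π) * M.mixture π w' ≤ b := by
  calc _ ≤ ∫ w' : M.Wage, b * M.mixture π w' :=
        integral_mono (integrable_mul_mixture hφ hC π) ((M.integrable_mixture π).const_mul b)
          fun w' => mul_le_mul_of_nonneg_right (hb _) (M.mixture_nonneg π w')
    _ = b := by rw [integral_const_mul, M.integral_mixture, mul_one]

theorem le_integral_mul_mixture {φ : M.State → ℝ} (hφ : Measurable φ) {C a : ℝ}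
    (hC : ∀ z, |φ z| ≤ C) (ha : ∀ z, a ≤ φ z) (π : I) :
    a ≤ ∫ w' : M.Wage, φ (w', M.update w' π) * M.mixture π w' := by
  calc a = ∫ w' : M.Wage, a * M.mixture π w' := by
        rw [integral_const_mul, M.integral_mixture, mul_one]
    _ ≤ _ := integral_mono ((M.integrable_mixture π).const_mul a) (integrable_mul_mixture hφ hC π)
          fun w' => mul_le_mul_of_nonneg_right (ha _) (M.mixture_nonneg π w')

theorem isBddMeasurable_Q {ψ : I → ℝ} (hψ : IsBddMeasurable ψ) : IsBddMeasurable (M.Q ψ) := by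
  obtain ⟨C, hC⟩ := exists_abs_exitOrContinue_le (M := M) hψ
  have hm := measurable_exitOrContinue (M := M) hψ
  constructor
  · have h : Measurable fun p : I × M.Wage =>
        M.exitOrContinue ψ (p.2, M.update p.2 p.1) * M.mixture p.1 p.2 :=
      (hm.comp (measurable_snd.prodMk (M.measurable_update.comp measurable_swap))).mul
        M.measurable_mixture
    exact (h.stronglyMeasurable.integral_prod_right'.measurable.const_mul M.β).const_add M.c₀
  · refine ⟨|M.c₀| + M.β * C, fun π => ?_⟩
    rw [Q_eq]
    refine (abs_add_le _ _).trans (add_le_add le_rfl ?_)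
    rw [abs_mul, abs_of_pos M.β_pos]
    refine mul_le_mul_of_nonneg_left (abs_le.2 ⟨?_, ?_⟩) M.β_pos.le
    · exact le_integral_mul_mixture hm hC (fun z => (abs_le.1 (hC z)).1) π
    · exact integral_mul_mixture_le hm hC (fun z => (abs_le.1 (hC z)).2) π

/-- The bound `D` is left free so that one estimate serves both `supNorm` on bounded Borel functions
and the metric of `C(I, ℝ)`. -/
theorem abs_Q_sub_Q_le {ψ φ : I → ℝ} (hψ : IsBddMeasurable ψ) (hφ : IsBddMeasurable φ) {D : ℝ}
    (hD : ∀ π, |ψ π - φ π| ≤ D) (π : I) : |M.Q ψ π - M.Q φ π| ≤ M.β * D := by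
  obtain ⟨C₁, hC₁⟩ := exists_abs_exitOrContinue_le (M := M) hψ
  obtain ⟨C₂, hC₂⟩ := exists_abs_exitOrContinue_le (M := M) hφ
  have h₁ := measurable_exitOrContinue (M := M) hψ
  have h₂ := measurable_exitOrContinue (M := M) hφ
  have hd : ∀ z : M.State, |M.exitOrContinue ψ z - M.exitOrContinue φ z| ≤ D := fun z => by
    unfold exitOrContinue
    rw [max_comm _ (ψ _), max_comm _ (φ _)]
    exact (abs_max_sub_max_le_abs _ _ _).trans (hD z.2)
  have key : M.Q ψ π - M.Q φ π = M.β * ∫ w' : M.Wage,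
      (M.exitOrContinue ψ - M.exitOrContinue φ) (w', M.update w' π) * M.mixture π w' := by
    simp only [Q_eq, Pi.sub_apply, sub_mul]
    rw [integral_sub (integrable_mul_mixture h₁ hC₁ π) (integrable_mul_mixture h₂ hC₂ π)]
    ring
  rw [key, abs_mul, abs_of_pos M.β_pos]
  refine mul_le_mul_of_nonneg_left (abs_le.2 ⟨?_, ?_⟩) M.β_pos.le
  · exact le_integral_mul_mixture (h₁.sub h₂) hd (fun z => (abs_le.1 (hd z)).1) π
  · exact integral_mul_mixture_le (h₁.sub h₂) hd (fun z => (abs_le.1 (hd z)).2) π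

theorem supNorm_Q_sub_Q_le {ψ φ : I → ℝ} (hψ : IsBddMeasurable ψ) (hφ : IsBddMeasurable φ) :
    supNorm (M.Q ψ - M.Q φ) ≤ M.β * supNorm (ψ - φ) :=
  ciSup_le fun π => abs_Q_sub_Q_le hψ hφ (hψ.sub hφ).abs_le_supNorm π

theorem eq_of_Q_eq_self {ψ φ : I → ℝ} (hψ : IsBddMeasurable ψ) (hφ : IsBddMeasurable φ)
    (hψQ : M.Q ψ = ψ) (hφQ : M.Q φ = φ) : φ = ψ := by
  have h := supNorm_Q_sub_Q_le (M := M) hφ hψ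
  rw [hψQ, hφQ] at h
  have h0 : supNorm (φ - ψ) ≤ 0 := by nlinarith [M.one_sub_β_pos]
  funext π
  exact sub_eq_zero.1 (abs_eq_zero.1
    (le_antisymm (((hφ.sub hψ).abs_le_supNorm π).trans h0) (abs_nonneg _)))

/-! ### Continuity and existence of the fixed point. -/

/-- Bayes' rule may fail to be continuous in the belief, but only where the weight vanishes. -/
theorem continuous_exitOrContinue_mul_mixture {ψ : I → ℝ} (hψ : Continuous ψ) (w' : M.Wage) :
    Continuous fun π => M.exitOrContinue ψ (w', M.update w' π) * M.mixture π w' := by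
  have hmix : Continuous fun π => M.mixture π w' := by
    unfold mixture
    fun_prop
  obtain ⟨C, hC⟩ := exists_abs_exitOrContinue_le (M := M) (.of_continuous hψ)
  rw [continuous_iff_continuousAt]
  intro π
  by_cases h : M.mixture π w' = 0
  · have hlim : Filter.Tendsto (fun π => M.mixture π w') (nhds π) (nhds 0) := h ▸ hmix.tendsto π
    rw [ContinuousAt, h, mul_zero]
    refine squeeze_zero_norm (fun π' => ?_) (by simpa using hlim.const_mul C)
    rw [Real.norm_eq_abs, abs_mul, abs_of_nonneg (M.mixture_nonneg π' w')]
    exact mul_le_mul_of_nonneg_right (hC _) (M.mixture_nonneg π' w')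
  · have hu : ContinuousAt (fun π => M.update w' π) π := by
      refine Topology.IsInducing.subtypeVal.continuousAt_iff.2 ?_
      exact (continuous_subtype_val.mul continuous_const).continuousAt.div hmix.continuousAt h
    exact (continuousAt_const.max (hψ.continuousAt.comp hu)).mul hmix.continuousAt

theorem continuous_Q {ψ : I → ℝ} (hψ : Continuous ψ) : Continuous (M.Q ψ) := by
  obtain ⟨C, hC⟩ := exists_abs_exitOrContinue_le (M := M) (.of_continuous hψ)
  have hm := measurable_exitOrContinue (M := M) (.of_continuous hψ)
  refine continuous_const.add (continuous_const.mul (continuous_of_dominated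
    (F := fun π w' => M.exitOrContinue ψ (w', M.update w' π) * M.mixture π w')
    (bound := fun w' => C * (M.f w' + M.g w'))
    (fun π => (integrable_mul_mixture hm hC π).aestronglyMeasurable)
    (fun π => Filter.Eventually.of_forall fun w' => ?_)
    ((M.f_density.integrable.add M.g_density.integrable).const_mul C)
    (Filter.Eventually.of_forall fun w' => continuous_exitOrContinue_mul_mixture hψ w')))
  rw [Real.norm_eq_abs, abs_mul, abs_of_nonneg (M.mixture_nonneg π w')]
  refine mul_le_mul (hC _) ?_ (M.mixture_nonneg π w') ((abs_nonneg _).trans (hC (w', π)))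
  unfold mixture
  -- The dominating function is free of `π` because `f + g - h_π = (1 - π) f + π g ≥ 0`.
  nlinarith [mul_nonneg π.2.1 (M.g_density.nonneg w'),
    mul_nonneg (sub_nonneg.2 π.2.2) (M.f_density.nonneg w')]

variable (M) in
theorem exists_continuous_Q_eq_self : ∃ ψ : I → ℝ, Continuous ψ ∧ M.Q ψ = ψ := by
  let T : C(I, ℝ) → C(I, ℝ) := fun ψ => ⟨M.Q ψ, continuous_Q ψ.continuous⟩
  have hT : ContractingWith ⟨M.β, M.β_pos.le⟩ T := by
    refine ⟨M.β_lt_one, LipschitzWith.of_dist_le_mul fun ψ φ => ?_⟩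
    refine (ContinuousMap.dist_le (mul_nonneg M.β_pos.le dist_nonneg)).2 fun π => ?_
    exact abs_Q_sub_Q_le (.of_continuous ψ.continuous) (.of_continuous φ.continuous)
      (fun π => (Real.dist_eq _ _).symm.trans_le (ContinuousMap.dist_apply_le_dist π)) π
  exact ⟨_, (ContractingWith.fixedPoint T hT).continuous,
    congrArg (fun ψ : C(I, ℝ) => (ψ : I → ℝ)) hT.fixedPoint_isFixedPt⟩

/-! ### Location of the reservation wage and the Bellman equation. -/

theorem reservation_mem_Icc (hc₀ : M.c₀ ∈ Icc M.wl M.wh) {ψ : I → ℝ} (hψ : Continuous ψ)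
    (hQ : M.Q ψ = ψ) (π : I) : (1 - M.β) * ψ π ∈ Icc M.wl M.wh := by
  have hβ := M.one_sub_β_pos
  have hβ0 := M.β_pos
  obtain ⟨C, hC⟩ := exists_abs_exitOrContinue_le (M := M) (.of_continuous hψ)
  have hm := measurable_exitOrContinue (M := M) (.of_continuous hψ)
  constructor
  -- The number `wl / (1 - β)` is the fixed point of `x ↦ wl + β x` and bounds the integrand from
  -- below.
  · have h := le_integral_mul_mixture hm hC (a := M.wl / (1 - M.β))
      (fun z => (M.exitPayoff_mem z).1.trans (le_max_left _ _)) π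
    rw [← hQ, Q_eq, ← div_le_iff₀' hβ]
    have h' : M.wl / (1 - M.β) = M.wl + M.β * (M.wl / (1 - M.β)) := by field_simp; ring
    rw [h']
    exact add_le_add hc₀.1 (mul_le_mul_of_nonneg_left h hβ0.le)
  -- At a maximizer `π₀` of `ψ`, a value above `wh / (1 - β)` would give `ψ π₀ ≤ wh + β ψ π₀`, a
  -- contradiction.
  · obtain ⟨π₀, -, hπ₀⟩ := isCompact_univ.exists_isMaxOn univ_nonempty hψ.continuousOn
    have h := integral_mul_mixture_le hm hC (b := max (M.wh / (1 - M.β)) (ψ π₀))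
      (fun z => max_le_max (M.exitPayoff_mem z).2 (hπ₀ (mem_univ z.2))) π₀
    have hfix : ψ π₀ ≤ M.wh + M.β * max (M.wh / (1 - M.β)) (ψ π₀) := by
      conv_lhs => rw [← hQ, Q_eq]
      exact add_le_add hc₀.2 (mul_le_mul_of_nonneg_left h hβ0.le)
    rw [← le_div_iff₀' hβ]
    refine (hπ₀ (mem_univ π)).trans (le_of_not_gt fun hlt => ?_)
    rw [max_eq_right hlt.le] at hfix
    rw [div_lt_iff₀ hβ] at hlt
    linarith

theorem integral_transition {φ : M.State → ℝ} (hφ : Measurable φ) (z : M.State) :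
    ∫ z', φ z' ∂(M.transition z) = ∫ w', φ (w', M.update w' z.2) * M.mixture z.2 w' := by
  have hz : Measurable fun w' : M.Wage => (w', M.update w' z.2) :=
    measurable_id.prodMk (M.measurable_update_left z.2)
  change ∫ z', φ z' ∂(((volume : Measure M.Wage).withDensity fun w' =>
    ENNReal.ofReal (M.mixture z.2 w')).map fun w' => (w', M.update w' z.2)) = _
  rw [integral_map hz.aemeasurable hφ.aestronglyMeasurable,
    integral_withDensity_eq_integral_toReal_smul (M.measurable_mixture_left z.2).ennreal_ofReal
      (Filter.Eventually.of_forall fun _ => ENNReal.ofReal_lt_top)]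
  refine integral_congr_ae (Filter.Eventually.of_forall fun w' => ?_)
  simp only [ENNReal.toReal_ofReal (M.mixture_nonneg z.2 w'), smul_eq_mul, mul_comm]

/-- The Bellman equation. -/
theorem continuation_eq {ψ : I → ℝ} (hψ : IsBddMeasurable ψ) (hQ : M.Q ψ = ψ) (z : M.State) :
    M.c₀ + M.β * ∫ z', M.exitOrContinue ψ z' ∂(M.transition z) = ψ z.2 := by
  rw [integral_transition (measurable_exitOrContinue hψ), ← Q_eq, hQ]

end SearchModel
end

/-! ### Discounted gains stopped at a random time. -/

noncomputable section
namespace SearchModel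

variable {M : SearchModel}

variable (M) in
/-- Accept an offer exactly when it is at least the reservation wage `(1 - β) ψ`. -/
abbrev reservationPolicy (ψ : I → ℝ) (z : M.State) : Fin 2 :=
  if (1 - M.β) * ψ z.2 ≤ (z.1 : ℝ) then 1 else 0

theorem reservationPolicy_eq_one_iff {ψ : I → ℝ} {z : M.State} :
    M.reservationPolicy ψ z = 1 ↔ ψ z.2 ≤ M.exitPayoff z := by
  rw [exitPayoff, le_div_iff₀' M.one_sub_β_pos]
  simp [reservationPolicy]

namespace StateChain

variable {Ω : Type*} [mΩ : MeasurableSpace Ω] (S : M.StateChain Ω)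

attribute [local instance] StateChain.isProbabilityMeasure

/-- The discounted payoff of collecting `c₀` up to time `n` and then the terminal reward `V`. -/
def gain (V : M.State → ℝ) (n : ℕ) (ω : Ω) : ℝ :=
  (∑ t ∈ Finset.range n, M.β ^ t * M.c₀) + M.β ^ n * V (S.Z n ω)

/-- The discounted payoff of stopping at `τ` with terminal reward `V`. -/
def stoppedGain (V : M.State → ℝ) (τ : Ω → WithTop ℕ) (ω : Ω) : ℝ :=
  if τ ω = ⊤ then ∑' t : ℕ, M.β ^ t * M.c₀ else S.gain V ((τ ω).untopD 0) ω

theorem payoff_eq_stoppedGain : S.payoff = S.stoppedGain M.exitPayoff := rfl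

theorem stoppedGain_of_eq_coe {V : M.State → ℝ} {τ : Ω → WithTop ℕ} {ω : Ω} {m : ℕ}
    (h : τ ω = WithTop.some m) : S.stoppedGain V τ ω = S.gain V m ω := by
  rw [stoppedGain, h, if_neg WithTop.coe_ne_top, WithTop.untopD_coe]

theorem stoppedGain_of_eq_top {V : M.State → ℝ} {τ : Ω → WithTop ℕ} {ω : Ω} (h : τ ω = ⊤) :
    S.stoppedGain V τ ω = ∑' t : ℕ, M.β ^ t * M.c₀ := if_pos h

/-- Nothing is asked on `τ = ∞`, where the terminal reward does not enter. -/
theorem stoppedGain_congr {V W : M.State → ℝ} {τ : Ω → WithTop ℕ} {ω : Ω}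
    (h : ∀ m : ℕ, τ ω = WithTop.some m → V (S.Z m ω) = W (S.Z m ω)) :
    S.stoppedGain V τ ω = S.stoppedGain W τ ω := by
  cases hτ : τ ω with
  | top => rw [S.stoppedGain_of_eq_top hτ, S.stoppedGain_of_eq_top hτ]
  | coe m => rw [S.stoppedGain_of_eq_coe hτ, S.stoppedGain_of_eq_coe hτ, gain, gain, h m hτ]

theorem measurable_Z (n : ℕ) : Measurable (S.Z n) := (S.adapted n).mono (S.ℱ.le n) le_rfl

variable {V : M.State → ℝ} {C : ℝ} {τ : Ω → WithTop ℕ}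

theorem measurable_gain (hV : Measurable V) (n : ℕ) : Measurable (S.gain V n) :=
  ((hV.comp (S.measurable_Z n)).const_mul _).const_add _

theorem abs_gain_le (hC : ∀ z, |V z| ≤ C) (n : ℕ) (ω : Ω) :
    |S.gain V n ω| ≤ |M.c₀| / (1 - M.β) + C := by
  have hβ := M.one_sub_β_pos
  refine (abs_add_le _ _).trans (add_le_add ?_ ?_)
  · rw [← Finset.sum_mul, abs_mul, div_eq_inv_mul,
      abs_of_nonneg (Finset.sum_nonneg fun t _ => pow_nonneg M.β_pos.le t)]
    refine mul_le_mul_of_nonneg_right ?_ (abs_nonneg _)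
    rw [← tsum_geometric_of_lt_one M.β_pos.le M.β_lt_one]
    exact (summable_geometric_of_lt_one M.β_pos.le M.β_lt_one).sum_le_tsum _
      fun t _ => pow_nonneg M.β_pos.le t
  · rw [abs_mul, abs_of_nonneg (pow_nonneg M.β_pos.le n)]
    exact (mul_le_of_le_one_left (abs_nonneg _)
      (pow_le_one₀ M.β_pos.le M.β_lt_one.le)).trans (hC _)

/-- Stopping at `min τ n` as a sum of one-step gains. -/
theorem stoppedGain_min_succ (V : M.State → ℝ) (τ : Ω → WithTop ℕ) (n : ℕ) (ω : Ω) :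
    S.stoppedGain V (fun ω => min (τ ω) (WithTop.some (n + 1))) ω =
      S.stoppedGain V (fun ω => min (τ ω) (WithTop.some n)) ω +
        {ω | WithTop.some n < τ ω}.indicator (fun ω => S.gain V (n + 1) ω - S.gain V n ω) ω := by
  by_cases h : WithTop.some n < τ ω
  · have h1 : (WithTop.some (n + 1)) ≤ τ ω := by
      cases hτ : τ ω with
      | top => exact le_top
      | coe m => rw [hτ] at h; exact WithTop.coe_le_coe.2 (WithTop.coe_lt_coe.1 h)
    rw [indicator_of_mem (show ω ∈ {ω | WithTop.some n < τ ω} from h), S.stoppedGain_of_eq_coe (min_eq_right h1),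
      S.stoppedGain_of_eq_coe (min_eq_right h.le), add_sub_cancel]
  · rw [indicator_of_notMem (show ω ∉ {ω | WithTop.some n < τ ω} from h), add_zero]
    have h0 := not_lt.1 h
    have h1 : τ ω ≤ (WithTop.some (n + 1)) := h0.trans (WithTop.coe_le_coe.2 n.le_succ)
    simp only [stoppedGain, min_eq_left h0, min_eq_left h1]

theorem stoppedGain_min_zero (V : M.State → ℝ) (τ : Ω → WithTop ℕ) (ω : Ω) :
    S.stoppedGain V (fun ω => min (τ ω) (WithTop.some 0)) ω = V (S.Z 0 ω) := by
  rw [S.stoppedGain_of_eq_coe (m := 0) (min_eq_right (zero_le (a := τ ω)))]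
  simp [gain]

/-- The one-step decomposition reduces this to the events `{n < τ}`, which lie in `ℱ n`. -/
theorem measurable_stoppedGain_min (hV : Measurable V) (hτ : IsStoppingTime S.ℱ τ) (n : ℕ) :
    Measurable (S.stoppedGain V fun ω => min (τ ω) (WithTop.some n)) := by
  induction n with
  | zero =>
    rw [funext (S.stoppedGain_min_zero V τ)]
    exact hV.comp (S.measurable_Z 0)
  | succ n ih =>
    rw [funext (S.stoppedGain_min_succ V τ n)]
    exact ih.add (((S.measurable_gain hV _).sub (S.measurable_gain hV _)).indicator
      (S.ℱ.le n _ (hτ.measurableSet_gt n)))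

theorem abs_stoppedGain_min_le (hC : ∀ z, |V z| ≤ C) (τ : Ω → WithTop ℕ) (n : ℕ) (ω : Ω) :
    |S.stoppedGain V (fun ω => min (τ ω) (WithTop.some n)) ω| ≤ |M.c₀| / (1 - M.β) + C := by
  have h : min (τ ω) (WithTop.some n) ≠ ⊤ :=
    ((min_le_right _ _).trans_lt (WithTop.coe_lt_top n)).ne
  rw [stoppedGain, if_neg h]
  exact S.abs_gain_le hC _ ω

/-- For finite `τ` the sequence is eventually constant; for `τ = ∞` the term `β^n V(Z_n)` vanishes
in the limit because `V` is bounded. -/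
theorem tendsto_stoppedGain_min (hC : ∀ z, |V z| ≤ C) (τ : Ω → WithTop ℕ) (ω : Ω) :
    Filter.Tendsto (fun n : ℕ => S.stoppedGain V (fun ω => min (τ ω) (WithTop.some n)) ω)
      Filter.atTop (nhds (S.stoppedGain V τ ω)) := by
  cases hτ : τ ω with
  | top =>
    have h (n : ℕ) : S.stoppedGain V (fun ω => min (τ ω) (WithTop.some n)) ω = S.gain V n ω :=
      S.stoppedGain_of_eq_coe (by simp [hτ])
    simp only [h, S.stoppedGain_of_eq_top hτ]
    have hsum : Summable fun t : ℕ => M.β ^ t * M.c₀ :=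
      (summable_geometric_of_lt_one M.β_pos.le M.β_lt_one).mul_right _
    have hpow := tendsto_pow_atTop_nhds_zero_of_lt_one M.β_pos.le M.β_lt_one
    rw [← add_zero (∑' t : ℕ, M.β ^ t * M.c₀)]
    refine hsum.hasSum.tendsto_sum_nat.add
      (squeeze_zero_norm (fun n => ?_) (by simpa using hpow.mul_const C))
    rw [Real.norm_eq_abs, abs_mul, abs_of_nonneg (pow_nonneg M.β_pos.le n)]
    exact mul_le_mul_of_nonneg_left (hC _) (pow_nonneg M.β_pos.le n)
  | coe m =>
    rw [S.stoppedGain_of_eq_coe hτ]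
    refine tendsto_const_nhds.congr' ?_
    filter_upwards [Filter.eventually_ge_atTop m] with n hn
    refine (S.stoppedGain_of_eq_coe ?_).symm
    rw [hτ]
    exact min_eq_left (WithTop.coe_le_coe.2 hn)

theorem measurable_stoppedGain (hV : Measurable V) (hC : ∀ z, |V z| ≤ C)
    (hτ : IsStoppingTime S.ℱ τ) : Measurable (S.stoppedGain V τ) :=
  measurable_of_tendsto_metrizable (fun n => S.measurable_stoppedGain_min hV hτ n)
    (tendsto_pi_nhds.2 fun ω => S.tendsto_stoppedGain_min hC τ ω)

theorem abs_stoppedGain_le (hC : ∀ z, |V z| ≤ C) (τ : Ω → WithTop ℕ) (ω : Ω) :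
    |S.stoppedGain V τ ω| ≤ |M.c₀| / (1 - M.β) + C :=
  le_of_tendsto (S.tendsto_stoppedGain_min hC τ ω).abs
    (Filter.Eventually.of_forall fun n => S.abs_stoppedGain_min_le hC τ n ω)

theorem integrable_stoppedGain (hV : Measurable V) (hC : ∀ z, |V z| ≤ C)
    (hτ : IsStoppingTime S.ℱ τ) (z : M.State) : Integrable (S.stoppedGain V τ) (S.P z) :=
  .of_bound (S.measurable_stoppedGain hV hC hτ).aestronglyMeasurable _
    (Filter.Eventually.of_forall (S.abs_stoppedGain_le hC τ))

theorem tendsto_integral_stoppedGain_min (hV : Measurable V) (hC : ∀ z, |V z| ≤ C)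
    (hτ : IsStoppingTime S.ℱ τ) (z : M.State) :
    Filter.Tendsto
      (fun n : ℕ => ∫ ω, S.stoppedGain V (fun ω => min (τ ω) (WithTop.some n)) ω ∂(S.P z))
      Filter.atTop (nhds (∫ ω, S.stoppedGain V τ ω ∂(S.P z))) :=
  tendsto_integral_of_dominated_convergence (fun _ => |M.c₀| / (1 - M.β) + C)
    (fun n => (S.measurable_stoppedGain_min hV hτ n).aestronglyMeasurable) (integrable_const _)
    (fun n => Filter.Eventually.of_forall (S.abs_stoppedGain_min_le hC τ n))
    (Filter.Eventually.of_forall (S.tendsto_stoppedGain_min hC τ))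

/-! ### The Markov property and the drift of the discounted gain. -/

theorem setIntegral_Z_succ (hV : Measurable V) (hC : ∀ z, |V z| ≤ C) (z : M.State) (n : ℕ)
    {A : Set Ω} (hA : MeasurableSet[S.ℱ n] A) :
    ∫ ω in A, V (S.Z (n + 1) ω) ∂(S.P z) =
      ∫ ω in A, (∫ z', V z' ∂(M.transition (S.Z n ω))) ∂(S.P z) := by
  -- The Markov property is given only for indicators of sets. Integrated over `A`, it identifies
  -- two measures, and these then integrate every bounded `V` alike.
  have hmap : ((S.P z).restrict A).map (S.Z (n + 1)) =
      M.transition ∘ₘ (((S.P z).restrict A).map (S.Z n)) := by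
    ext B hB
    have hB' := S.measurable_Z (n + 1) hB
    have hint : Integrable ((S.Z (n + 1) ⁻¹' B).indicator fun _ => (1 : ℝ)) (S.P z) :=
      (integrable_const 1).indicator hB'
    have h := setIntegral_condExp (S.ℱ.le n) hint hA
    rw [setIntegral_congr_ae (S.ℱ.le n _ hA)
      ((S.markov z n B hB).mono fun ω hω _ => hω), integral_indicator_const _ hB', smul_eq_mul,
      mul_one] at h
    have hmeas : Measurable fun ω => M.transition (S.Z n ω) B :=
      (M.transition.measurable_coe hB).comp (S.measurable_Z n)
    rw [Measure.map_apply (S.measurable_Z _) hB, Measure.bind_apply hB M.transition.aemeasurable,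
      lintegral_map (M.transition.measurable_coe hB) (S.measurable_Z n)]
    simp only [measureReal_def] at h
    rw [integral_toReal hmeas.aemeasurable
      (Filter.Eventually.of_forall fun ω => measure_lt_top _ _)] at h
    refine ((ENNReal.toReal_eq_toReal_iff' ?_ (measure_ne_top _ _)).1 h).symm
    -- Finiteness is needed to pass back from `toReal`; the kernel has mass at most one, so the
    -- integral is at most the mass of `A`.
    refine ne_top_of_le_ne_top (measure_ne_top ((S.P z).restrict A) univ) ?_
    rw [← lintegral_one]
    exact lintegral_mono fun ω => prob_le_one
  have hVs := hV.stronglyMeasurable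
  have hi : Integrable V (M.transition ∘ₘ (((S.P z).restrict A).map (S.Z n))) := by
    have : IsFiniteMeasure (M.transition ∘ₘ (((S.P z).restrict A).map (S.Z n))) := by
      rw [← hmap]; infer_instance
    exact .of_bound hV.aestronglyMeasurable C (Filter.Eventually.of_forall hC)
  rw [← integral_map (S.measurable_Z _).aemeasurable hV.aestronglyMeasurable, hmap,
    Measure.comp_eq_comp_const_apply, Kernel.integral_comp (Measure.comp_eq_comp_const_apply ▸ hi),
    Kernel.const_apply, integral_map (S.measurable_Z _).aemeasurable]
  exact hVs.integral_kernel.aestronglyMeasurable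

theorem integrable_of_abs_le {φ : M.State → ℝ} (hφ : Measurable φ) {D : ℝ} (hD : ∀ z, |φ z| ≤ D)
    (n : ℕ) (μ : Measure Ω) [IsFiniteMeasure μ] : Integrable (fun ω => φ (S.Z n ω)) μ :=
  .of_bound (hφ.comp (S.measurable_Z n)).aestronglyMeasurable D
    (Filter.Eventually.of_forall fun _ => hD _)

/-- The Markov property replaces `V(Z_{n+1})` by its kernel average, and the Bellman equation
evaluates `c₀` plus `β` times that average as `ψ`. -/
theorem setIntegral_gain_succ_sub {ψ : I → ℝ} (hψ : IsBddMeasurable ψ) (hQ : M.Q ψ = ψ)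
    (z : M.State) (n : ℕ) {A : Set Ω} (hA : MeasurableSet[S.ℱ n] A) :
    ∫ ω in A, (S.gain (M.exitOrContinue ψ) (n + 1) ω - S.gain (M.exitOrContinue ψ) n ω) ∂(S.P z) =
      ∫ ω in A, M.β ^ n * (ψ (S.Z n ω).2 - M.exitOrContinue ψ (S.Z n ω)) ∂(S.P z) := by
  obtain ⟨C, hC⟩ := exists_abs_exitOrContinue_le (M := M) hψ
  obtain ⟨D, hD⟩ := hψ.2
  have hV := measurable_exitOrContinue (M := M) hψ
  have hmarkov := S.setIntegral_Z_succ hV hC z n hA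
  have i₁ := S.integrable_of_abs_le hV hC (n + 1) ((S.P z).restrict A)
  have i₂ := S.integrable_of_abs_le hV hC n ((S.P z).restrict A)
  have i₃ := S.integrable_of_abs_le (φ := fun z => ψ z.2) (hψ.1.comp measurable_snd)
    (fun z => hD z.2) n ((S.P z).restrict A)
  have hb (ω : Ω) : ∫ z', M.exitOrContinue ψ z' ∂(M.transition (S.Z n ω)) =
      M.β⁻¹ * (ψ (S.Z n ω).2 - M.c₀) := by
    rw [← continuation_eq hψ hQ (S.Z n ω), add_sub_cancel_left, inv_mul_cancel_left₀ M.β_pos.ne']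
  simp only [hb] at hmarkov
  rw [integral_const_mul, integral_sub i₃ (integrable_const _)] at hmarkov
  have hl (ω : Ω) : S.gain (M.exitOrContinue ψ) (n + 1) ω - S.gain (M.exitOrContinue ψ) n ω =
      M.β ^ n * ((M.c₀ + M.β * M.exitOrContinue ψ (S.Z (n + 1) ω))
        - M.exitOrContinue ψ (S.Z n ω)) := by
    rw [gain, gain, Finset.sum_range_succ, pow_succ]
    ring
  simp only [hl]
  rw [integral_const_mul, integral_const_mul, integral_sub
    (f := fun ω => M.c₀ + M.β * M.exitOrContinue ψ (S.Z (n + 1) ω))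
    ((integrable_const _).add (i₁.const_mul _)) i₂, integral_add (integrable_const _) (i₁.const_mul _),
    integral_const_mul, hmarkov, mul_inv_cancel_left₀ M.β_pos.ne', integral_sub i₃ i₂,
    add_sub_cancel]

/-- One step of optional stopping: only paths still running after time `n` contribute drift, and
that event is known at time `n`. -/
theorem integral_stoppedGain_min_succ {ψ : I → ℝ} (hψ : IsBddMeasurable ψ) (hQ : M.Q ψ = ψ)
    (hτ : IsStoppingTime S.ℱ τ) (z : M.State) (n : ℕ) :
    ∫ ω, S.stoppedGain (M.exitOrContinue ψ) (fun ω => min (τ ω) (WithTop.some (n + 1))) ω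
        ∂(S.P z) =
      ∫ ω, S.stoppedGain (M.exitOrContinue ψ) (fun ω => min (τ ω) (WithTop.some n)) ω ∂(S.P z) +
      ∫ ω in {ω | WithTop.some n < τ ω},
        M.β ^ n * (ψ (S.Z n ω).2 - M.exitOrContinue ψ (S.Z n ω)) ∂(S.P z) := by
  obtain ⟨C, hC⟩ := exists_abs_exitOrContinue_le (M := M) hψ
  have hV := measurable_exitOrContinue (M := M) hψ
  have hA := hτ.measurableSet_gt n
  have hi (k : ℕ) : Integrable (S.gain (M.exitOrContinue ψ) k) (S.P z) :=
    .of_bound (S.measurable_gain hV k).aestronglyMeasurable _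
      (Filter.Eventually.of_forall (S.abs_gain_le hC k))
  simp only [S.stoppedGain_min_succ (M.exitOrContinue ψ) τ n]
  rw [integral_add (S.integrable_stoppedGain hV hC (hτ.min_const n) z)
    (show Integrable ({ω | WithTop.some n < τ ω}.indicator fun ω =>
      S.gain (M.exitOrContinue ψ) (n + 1) ω - S.gain (M.exitOrContinue ψ) n ω) (S.P z) from
      ((hi _).sub (hi _)).indicator (S.ℱ.le n _ hA)), integral_indicator (S.ℱ.le n _ hA),
    S.setIntegral_gain_succ_sub hψ hQ z n hA]

theorem integral_stoppedGain_min_zero (V : M.State → ℝ) (τ : Ω → WithTop ℕ) (z : M.State) :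
    ∫ ω, S.stoppedGain V (fun ω => min (τ ω) (WithTop.some 0)) ω ∂(S.P z) = V z := by
  simp only [S.stoppedGain_min_zero V τ]
  rw [integral_congr_ae ((S.initial z).mono fun ω hω => congrArg V hω)]
  simp

/-- Supermartingale half: each drift term is nonpositive since `ψ ≤ V`. -/
theorem integral_stoppedGain_le {ψ : I → ℝ} (hψ : IsBddMeasurable ψ) (hQ : M.Q ψ = ψ)
    (hτ : IsStoppingTime S.ℱ τ) (z : M.State) :
    ∫ ω, S.stoppedGain (M.exitOrContinue ψ) τ ω ∂(S.P z) ≤ M.exitOrContinue ψ z := by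
  obtain ⟨C, hC⟩ := exists_abs_exitOrContinue_le (M := M) hψ
  refine le_of_tendsto (S.tendsto_integral_stoppedGain_min (measurable_exitOrContinue hψ) hC hτ z)
    (Filter.Eventually.of_forall fun n => ?_)
  induction n with
  | zero => exact (S.integral_stoppedGain_min_zero _ τ z).le
  | succ n ih =>
    rw [S.integral_stoppedGain_min_succ hψ hQ hτ z n]
    refine (add_le_of_nonpos_right (integral_nonpos fun ω => ?_)).trans ih
    exact mul_nonpos_of_nonneg_of_nonpos (pow_nonneg M.β_pos.le n)
      (sub_nonpos.2 (le_max_right _ _))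

/-- Martingale half: `hcont` makes every drift term vanish as long as `τ` has not occurred. -/
theorem integral_stoppedGain_eq {ψ : I → ℝ} (hψ : IsBddMeasurable ψ) (hQ : M.Q ψ = ψ)
    (hτ : IsStoppingTime S.ℱ τ)
    (hcont : ∀ ω (n : ℕ), WithTop.some n < τ ω → M.exitOrContinue ψ (S.Z n ω) = ψ (S.Z n ω).2)
    (z : M.State) :
    ∫ ω, S.stoppedGain (M.exitOrContinue ψ) τ ω ∂(S.P z) = M.exitOrContinue ψ z := by
  obtain ⟨C, hC⟩ := exists_abs_exitOrContinue_le (M := M) hψ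
  refine tendsto_nhds_unique
    (S.tendsto_integral_stoppedGain_min (measurable_exitOrContinue hψ) hC hτ z)
    (tendsto_const_nhds.congr fun n => ?_)
  induction n with
  | zero => exact (S.integral_stoppedGain_min_zero _ τ z).symm
  | succ n ih =>
    rw [S.integral_stoppedGain_min_succ hψ hQ hτ z n, ← ih]
    refine (add_eq_left.2 ?_).symm
    refine setIntegral_eq_zero_of_forall_eq_zero fun ω hω => ?_
    rw [hcont ω n hω, sub_self, mul_zero]

/-! ### Verification: value function and optimality. -/

theorem integrable_payoff (hτ : IsStoppingTime S.ℱ τ) (z : M.State) :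
    Integrable (S.payoff τ) (S.P z) :=
  S.integrable_stoppedGain M.measurable_exitPayoff M.abs_exitPayoff_le hτ z

theorem expectedPayoff_le {ψ : I → ℝ} (hψ : IsBddMeasurable ψ) (hQ : M.Q ψ = ψ)
    (hτ : IsStoppingTime S.ℱ τ) (z : M.State) :
    S.expectedPayoff τ z ≤ M.exitOrContinue ψ z := by
  obtain ⟨C, hC⟩ := exists_abs_exitOrContinue_le (M := M) hψ
  refine (integral_mono (S.integrable_payoff hτ z) (S.integrable_stoppedGain
    (measurable_exitOrContinue hψ) hC hτ z) fun ω => ?_).trans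
    (S.integral_stoppedGain_le hψ hQ hτ z)
  rw [payoff_eq_stoppedGain]
  cases hω : τ ω with
  | top => rw [S.stoppedGain_of_eq_top hω, S.stoppedGain_of_eq_top hω]
  | coe m =>
    rw [S.stoppedGain_of_eq_coe hω, S.stoppedGain_of_eq_coe hω]
    exact add_le_add le_rfl
      (mul_le_mul_of_nonneg_left (le_max_left _ _) (pow_nonneg M.β_pos.le m))

theorem isStoppingTime_policyTime {ψ : I → ℝ} (hψ : Measurable ψ) :
    IsStoppingTime S.ℱ (S.policyTime (M.reservationPolicy ψ)) := by
  refine Adapted.isStoppingTime_hittingAfter S.adapted ?_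
  simp only [reservationPolicy_eq_one_iff]
  exact measurableSet_le (hψ.comp measurable_snd) M.measurable_exitPayoff

/-- On stopping, the exit payoff is at least `ψ`, so it may be replaced by `V`; before stopping it
is below `ψ`, so `V = ψ` and the martingale half applies. -/
theorem expectedPayoff_policyTime {ψ : I → ℝ} (hψ : IsBddMeasurable ψ) (hQ : M.Q ψ = ψ)
    (z : M.State) :
    S.expectedPayoff (S.policyTime (M.reservationPolicy ψ)) z = M.exitOrContinue ψ z := by
  rw [← S.integral_stoppedGain_eq hψ hQ (S.isStoppingTime_policyTime hψ.1) (fun ω n hn => ?_) z]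
  · refine integral_congr_ae (Filter.Eventually.of_forall fun ω => S.stoppedGain_congr ?_)
    intro m hm
    have h := hittingAfter_mem_set_of_ne_top
      (show S.policyTime (M.reservationPolicy ψ) ω ≠ ⊤ from hm ▸ WithTop.coe_ne_top)
    change S.Z ((S.policyTime (M.reservationPolicy ψ) ω).untopA) ω ∈ _ at h
    rw [hm] at h
    exact (max_eq_left (reservationPolicy_eq_one_iff.1 h)).symm
  · have h := notMem_of_lt_hittingAfter hn (Nat.zero_le n)
    refine max_eq_right (le_of_not_ge fun hle => h ?_)
    exact reservationPolicy_eq_one_iff.2 hle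

theorem value_eq {ψ : I → ℝ} (hψ : IsBddMeasurable ψ) (hQ : M.Q ψ = ψ) (z : M.State) :
    S.value z = M.exitOrContinue ψ z := by
  have hτ := S.isStoppingTime_policyTime hψ.1
  have hle : ∀ x ∈ {x | ∃ τ : Ω → WithTop ℕ, IsStoppingTime S.ℱ τ ∧ (∀ᵐ ω ∂(S.P z), τ ω ≠ ⊤) ∧
      x = S.expectedPayoff τ z}, x ≤ M.exitOrContinue ψ z := by
    rintro _ ⟨τ, hτ, -, rfl⟩
    exact S.expectedPayoff_le hψ hQ hτ z
  -- The policy time may be infinite and hence not admissible in the supremum. Its truncations are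
  -- admissible, and their payoffs converge to its own.
  have hmem (n : ℕ) := show S.expectedPayoff
      (fun ω => min (S.policyTime (M.reservationPolicy ψ) ω) (WithTop.some n)) z ∈
      {x | ∃ τ : Ω → WithTop ℕ, IsStoppingTime S.ℱ τ ∧ (∀ᵐ ω ∂(S.P z), τ ω ≠ ⊤) ∧
      x = S.expectedPayoff τ z} from ⟨_, hτ.min_const n, Filter.Eventually.of_forall fun ω =>
        ((min_le_right _ _).trans_lt (WithTop.coe_lt_top n)).ne, rfl⟩
  refine le_antisymm (csSup_le ⟨_, hmem 0⟩ hle) ?_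
  rw [← S.expectedPayoff_policyTime hψ hQ z]
  exact le_of_tendsto (S.tendsto_integral_stoppedGain_min M.measurable_exitPayoff
    M.abs_exitPayoff_le hτ z) (Filter.Eventually.of_forall fun n => le_csSup ⟨_, hle⟩ (hmem n))

theorem continuationValue_eq {ψ : I → ℝ} (hψ : IsBddMeasurable ψ) (hQ : M.Q ψ = ψ)
    (z : M.State) : S.continuationValue z = ψ z.2 := by
  rw [continuationValue, funext (S.value_eq hψ hQ), continuation_eq hψ hQ]

theorem isReservationWage {ψ : I → ℝ} (hψ : Continuous ψ) (hQ : M.Q ψ = ψ)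
    (hc₀ : M.c₀ ∈ Icc M.wl M.wh) : S.IsReservationWage fun π => (1 - M.β) * ψ π := by
  refine fun π => ⟨reservation_mem_Icc hc₀ hψ hQ π, fun w => ?_⟩
  rw [S.continuationValue_eq (.of_continuous hψ) hQ, exitPayoff, div_eq_iff M.one_sub_β_pos.ne',
    mul_comm]

theorem isOptimalPolicy {ψ : I → ℝ} (hψ : IsBddMeasurable ψ) (hQ : M.Q ψ = ψ) :
    S.IsOptimalPolicy (M.reservationPolicy ψ) :=
  ⟨S.isStoppingTime_policyTime hψ.1, fun z =>
    ⟨(S.expectedPayoff_policyTime hψ hQ z).trans (S.value_eq hψ hQ z).symm, fun _ hτ =>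
      (S.expectedPayoff_le hψ hQ hτ z).trans_eq (S.expectedPayoff_policyTime hψ hQ z).symm⟩⟩

theorem continuous_value {ψ : I → ℝ} (hψ : Continuous ψ) (hQ : M.Q ψ = ψ) :
    Continuous S.value := by
  rw [funext (S.value_eq (.of_continuous hψ) hQ)]
  exact ((continuous_subtype_val.comp continuous_fst).div_const _).max (hψ.comp continuous_snd)

end StateChain

end SearchModel

end

theorem mainTheorem10 (M : SearchModel) (hc₀ : M.c₀ ∈ Icc M.wl M.wh) :
    -- `Q` is a contraction of modulus `β` on `b[0,1]`
    (∀ ψ : I → ℝ, IsBddMeasurable ψ → IsBddMeasurable (M.Q ψ)) ∧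
    (∀ ψ φ : I → ℝ, IsBddMeasurable ψ → IsBddMeasurable φ →
      supNorm (M.Q ψ - M.Q φ) ≤ M.β * supNorm (ψ - φ)) ∧
    -- with a unique fixed point `ψ`
    ∃ ψ : I → ℝ, IsBddMeasurable ψ ∧ M.Q ψ = ψ ∧
      (∀ φ : I → ℝ, IsBddMeasurable φ → M.Q φ = φ → φ = ψ) ∧
      Continuous ψ ∧
      Continuous (fun π : I => (1 - M.β) * ψ π) ∧
      -- for the state process on any filtered space
      ∀ {Ω : Type*} [MeasurableSpace Ω] (S : M.StateChain Ω),
        (∀ (z : M.State) (τ : Ω → WithTop ℕ), IsStoppingTime S.ℱ τ →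
          Integrable (S.payoff τ) (S.P z)) ∧
        (∀ z : M.State, S.continuationValue z = ψ z.2) ∧
        (∀ z : M.State, S.value z = max ((z.1 : ℝ) / (1 - M.β)) (ψ z.2)) ∧
        S.IsReservationWage (fun π => (1 - M.β) * ψ π) ∧
        S.IsOptimalPolicy (fun z => if (1 - M.β) * ψ z.2 ≤ (z.1 : ℝ) then 1 else 0) ∧
        Continuous S.value := by
  obtain ⟨ψ, hcont, hQ⟩ := M.exists_continuous_Q_eq_self
  have hψ : IsBddMeasurable ψ := .of_continuous hcont
  refine ⟨fun _ => SearchModel.isBddMeasurable_Q, fun _ _ => SearchModel.supNorm_Q_sub_Q_le,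
    ψ, hψ, hQ, fun φ hφ h => SearchModel.eq_of_Q_eq_self hψ hφ hQ h, hcont,
    continuous_const.mul hcont, fun S => ⟨fun z τ hτ => S.integrable_payoff hτ z,
    S.continuationValue_eq hψ hQ, S.value_eq hψ hQ, S.isReservationWage hcont hQ hc₀,
    S.isOptimalPolicy hψ hQ, S.continuous_value hcont hQ⟩⟩
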